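/- Let $N_1, N_2 > 1$ be integers, let $K$ be an (ordinary) differential field of characteristic $p \ge 0$ with derivation $D$, and let $F$ be a differential field extension of $K$. Assume that $p = 0$, or that $K$ is infinite and perfect. Let $L_1(Y) = \sum_{i=0}^{N_1} a_i\, D^i Y$ and $L_2(Y) = \sum_{i=0}^{N_2} b_i\, D^i Y$, with $a_i, b_i \in K$, $a_{N_1} \neq 0$ and $b_{N_2} \neq 0$, be homogeneous linear differential polynomials of orders $N_1$ and $N_2$, and let $y \in F$, $y \neq 0$. (1) If $L_1(y) = L_2(1/y) = 0$, and $p = 0$ or $p > N_1 + N_2 - 2$, then for every $j = 1, \ldots, N_1 - 1$ the element $D^j y / y$ is algebraic over $K$, of degree at most $\binom{N_2 + N_1 - 2}{N_1 - 1}$. (2) If $q \ge N_2$ is an integer with $L_1(y) = L_2(y^q) = 0$, and $p = 0$ or $p > (q+1)(N_1 - 1) - 1$, then for every $j = 1, \ldots, N_1 - 1$ the element $D^j y / y$ is algebraic over $K$, of degree at most $\binom{q(N_1 - 1) + N_1 - 2}{N_1 - 1}$. -/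

import Mathlib

/-- A homogeneous linear differential polynomial `L(Y) = ∑ i, aᵢ Y⁽ⁱ⁾` with coefficients in `K`,
given by its finitely supported family of coefficients (`coeff i` is the coefficient of `Y⁽ⁱ⁾`). -/
structure HomLinDiffPoly (K : Type*) [Field K] where
  coeff : ℕ →₀ K

namespace HomLinDiffPoly

/-- `L` is nonzero of order `N`: the highest derivative of `Y` occurring in `L` is the `N`-th. -/
def HasOrder {K : Type*} [Field K] (L : HomLinDiffPoly K) (N : ℕ) : Prop :=
  L.coeff N ≠ 0 ∧ ∀ i, N < i → L.coeff i = 0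

/-- The value `L(y) = ∑ i, aᵢ Dⁱy` at an element `y` of a differential extension field. -/
noncomputable def eval {K F : Type*} [Field K] [Field F] [Differential F] [Algebra K F]
    (L : HomLinDiffPoly K) (y : F) : F :=
  L.coeff.sum fun i a => algebraMap K F a * (Differential.deriv : Derivation ℤ F F)^[i] y

end HomLinDiffPoly

/-- `x` is algebraic over `K`, of degree at most `d`. -/
def AlgebraicOfDegreeLE (K : Type*) {F : Type*} [Field K] [Field F] [Algebra K F]
    (x : F) (d : ℕ) : Prop :=
  IsAlgebraic K x ∧ (minpoly K x).natDegree ≤ d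

/-! Put n = N₁ − 1, x_i = Dⁱy / y and z = y ^ e, with e = −1 or e = q. Then z⁽ᵏ⁾ / z is a polynomial
in the x_i with integer coefficients, isobaric of weight k when x_i has weight i. Through L₁, each
x_i with i > n becomes an expression of lower weight in x_1, …, x_n; through L₂, z⁽ᵏ⁾ / z with k ≥
N₂ becomes a combination of those with k < N₂. The indices k = N₂, …, N₂ + n − 1 therefore give n
polynomial equations f = 0 in n unknowns, whose top-weight parts g arise by setting x_i = 0 for i >
n.

The forms g have only the trivial common zero (`eq_zero_of_powDerivSeq_eq_zero`); this is where the
bound on the characteristic enters. A weighted Bézout bound (`exists_monic_of_common_zero`) then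
gives degree at most ∏ (N₂ + i) / ∏ (i + 1) over i < n, which is the binomial coefficient of N₂ + n
− 1 over n. For that bound, K[x] is finite over K[f], a comparison of Hilbert functions bounds the
degree of the minimal polynomial of x_j over K[f], and specialising f to 0 keeps this polynomial
monic. -/

open MvPolynomial Finsupp in
theorem MvPolynomial.weightedHomogeneousComponent_mul_of_isWeightedHomogeneous
    {σ K : Type*} [CommRing K] {w : σ → ℕ} {g : MvPolynomial σ K} {d : ℕ}
    (hg : IsWeightedHomogeneous w g d) (m : ℕ) (h : MvPolynomial σ K) :
    weightedHomogeneousComponent w m (h * g) =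
      if d ≤ m then weightedHomogeneousComponent w (m - d) h * g else 0 := by
  classical
  induction h using MvPolynomial.induction_on' with
  | monomial a c =>
    have h1 : IsWeightedHomogeneous w (monomial a c : MvPolynomial σ K) (weight w a) :=
      isWeightedHomogeneous_monomial _ _ _ rfl
    have h2 := h1.mul hg
    rw [weightedHomogeneousComponent_of_mem h2, weightedHomogeneousComponent_of_mem h1]
    split_ifs <;> first | rfl | omega
  | add p q hp hq =>
    rw [add_mul, map_add, hp, hq, map_add]
    split_ifs <;> ring

/-! ### The weight filtration, and finiteness over a subring with nondegenerate leading forms. -/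

namespace MvPolynomial

/-- Polynomials all of whose monomials have weight less than `m`. -/
noncomputable def weightLT {σ : Type*} (K : Type*) [CommRing K] (w : σ → ℕ) (m : ℕ) :
    Submodule K (MvPolynomial σ K) :=
  restrictSupport K {a | Finsupp.weight w a < m}

section weightLT

variable {σ K : Type*} [CommRing K] {w : σ → ℕ}

theorem weightLT_mono {a b : ℕ} (h : a ≤ b) : weightLT K w a ≤ weightLT K w b :=
  restrictSupport_mono _ fun _ hx => lt_of_lt_of_le hx h

/-- The index `a + 1` means weight at most `a`; one strict bound is enough to make the product
strict. -/
theorem mul_mem_weightLT {a b : ℕ} {p q : MvPolynomial σ K} (hp : p ∈ weightLT K w (a + 1))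
    (hq : q ∈ weightLT K w b) : p * q ∈ weightLT K w (a + b) := by
  have h := Submodule.mul_mem_mul hp hq
  rw [weightLT, weightLT, ← restrictSupport_add] at h
  refine restrictSupport_mono _ ?_ h
  rintro _ ⟨x, hx, y, hy, rfl⟩
  simp only [Set.mem_ofPred_eq, map_add] at *
  omega

theorem IsWeightedHomogeneous.mem_weightLT {p : MvPolynomial σ K} {m : ℕ}
    (hp : IsWeightedHomogeneous w p m) : p ∈ weightLT K w (m + 1) := by
  rw [weightLT, mem_restrictSupport_iff]
  intro a ha
  have := hp (mem_support_iff.1 ha)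
  simp [this]

theorem C_mem_weightLT (c : K) : (C c : MvPolynomial σ K) ∈ weightLT K w 1 := by
  simpa using (isWeightedHomogeneous_C w c).mem_weightLT

theorem X_mem_weightLT (j : σ) : (X j : MvPolynomial σ K) ∈ weightLT K w (w j + 1) :=
  (isWeightedHomogeneous_X K w j).mem_weightLT

theorem pow_mem_weightLT {a : ℕ} {p : MvPolynomial σ K} (hp : p ∈ weightLT K w (a + 1)) (k : ℕ) :
    p ^ k ∈ weightLT K w (k * a + 1) := by
  induction k with
  | zero => simpa using C_mem_weightLT (1 : K)
  | succ k ih =>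
    rw [pow_succ]
    have := mul_mem_weightLT ih hp
    convert this using 2
    ring

theorem prod_pow_mem_weightLT {ι : Type*} [Fintype ι] {f : ι → MvPolynomial σ K} {d : ι → ℕ}
    (hf : ∀ i, f i ∈ weightLT K w (d i + 1)) (b : ι →₀ ℕ) :
    b.prod (fun i k => f i ^ k) ∈ weightLT K w (Finsupp.weight d b + 1) := by
  classical
  rw [Finsupp.weight_apply, Finsupp.prod, Finsupp.sum]
  induction b.support using Finset.induction_on with
  | empty => simpa using C_mem_weightLT (1 : K)
  | insert i s hi ih =>
    rw [Finset.prod_insert hi, Finset.sum_insert hi, add_assoc]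
    exact mul_mem_weightLT (by simpa using pow_mem_weightLT (hf i) (b i)) ih

/-- Graded Nakayama: the finitely many monomials with every exponent below `M j` generate. Any other
monomial lies in the ideal of the `g i`, and trading `g i` for `f i` leaves an error of lower
weight, so induction on the weight applies. -/
theorem finite_aeval_of_X_mem_radical {ι : Type*} [Finite σ] [Finite ι]
    {f g : ι → MvPolynomial σ K} {d : ι → ℕ} (hd : ∀ i, 0 < d i)
    (hg : ∀ i, IsWeightedHomogeneous w (g i) (d i))
    (hfg : ∀ i, f i - g i ∈ weightLT K w (d i))
    (hrad : ∀ j, X j ∈ (Ideal.span (Set.range g)).radical) :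
    (aeval (R := K) f : MvPolynomial ι K →ₐ[K] MvPolynomial σ K).toRingHom.Finite := by
  classical
  cases nonempty_fintype σ
  cases nonempty_fintype ι
  set φ : MvPolynomial ι K →ₐ[K] MvPolynomial σ K := aeval f
  let _ := φ.toRingHom.toAlgebra
  have hsmul : ∀ (a : MvPolynomial ι K) (p : MvPolynomial σ K), a • p = φ a * p := fun _ _ => rfl
  choose M hM using hrad
  have hfin : {a : σ →₀ ℕ | ∀ j, a j < M j}.Finite := by
    refine Set.Finite.subset (Set.finite_Iic (Finsupp.equivFunOnFinite.symm M)) ?_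
    intro a ha j
    exact (ha j).le
  set S : Set (MvPolynomial σ K) := (fun a => monomial a 1) '' {a : σ →₀ ℕ | ∀ j, a j < M j}
  have hC : ∀ (c : K), ∀ p ∈ Submodule.span (MvPolynomial ι K) S,
      c • p ∈ Submodule.span (MvPolynomial ι K) S := by
    intro c p hp
    have : c • p = (C c : MvPolynomial ι K) • p := by
      rw [hsmul, aeval_C, algebraMap_eq, smul_eq_C_mul]
    rw [this]
    exact Submodule.smul_mem _ _ hp
  have key : ∀ m, ∀ p ∈ weightLT K w m, p ∈ Submodule.span (MvPolynomial ι K) S := by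
    intro m
    induction m with
    | zero =>
      intro p hp
      rw [weightLT, mem_restrictSupport_iff] at hp
      have : p = 0 := by
        rw [← support_eq_empty, Finset.eq_empty_iff_forall_notMem]
        intro a ha
        have := hp ha
        simp at this
      rw [this]
      exact zero_mem _
    | succ m ih =>
      intro p hp
      rw [weightLT, restrictSupport_eq_span] at hp
      induction hp using Submodule.span_induction with
      | zero => exact zero_mem _
      | add x y _ _ hx hy => exact add_mem hx hy
      | smul c x _ hx => exact hC c x hx
      | mem x hx =>
        obtain ⟨a, ha, rfl⟩ := hx
        rcases lt_or_eq_of_le (Nat.lt_succ_iff.1 ha) with hlt | heq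
        · refine ih _ ?_
          rw [weightLT, monomial_mem_restrictSupport]
          exact Or.inl hlt
        by_cases hs : ∀ j, a j < M j
        · exact Submodule.subset_span ⟨a, hs, rfl⟩
        push Not at hs
        obtain ⟨j, hj⟩ := hs
        have hmem : (monomial a 1 : MvPolynomial σ K) ∈ Ideal.span (Set.range g) := by
          refine Ideal.mem_of_dvd _ ?_ (hM j)
          rw [X_pow_eq_monomial, monomial_dvd_monomial]
          refine ⟨Or.inr ?_, dvd_rfl⟩
          simpa using hj
        rw [Ideal.mem_span_range_iff_exists_fun] at hmem
        obtain ⟨h, hh⟩ := hmem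
        have hhom : IsWeightedHomogeneous w (monomial a 1 : MvPolynomial σ K) m :=
          isWeightedHomogeneous_monomial _ _ _ heq
        have h1 := weightedHomogeneousComponent_of_mem (m := m) hhom
        -- Taking the component of weight `m` makes the coefficients homogeneous, of weight `m - d
        -- i`.
        rw [if_pos rfl, ← hh, map_sum] at h1
        simp only [weightedHomogeneousComponent_mul_of_isWeightedHomogeneous (hg _)] at h1
        change monomial a 1 ∈ _
        rw [← hh, ← h1]
        refine sum_mem fun i _ => ?_
        split_ifs with hdm
        · set h' := weightedHomogeneousComponent w (m - d i) (h i)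
          have hh' : h' ∈ weightLT K w (m - d i + 1) :=
            (weightedHomogeneousComponent_isWeightedHomogeneous (w := w) (m - d i) (h i)).mem_weightLT
          have e : h' * g i = (X i : MvPolynomial ι K) • h' - h' * (f i - g i) := by
            rw [hsmul]
            simp only [φ, aeval_X]
            ring
          rw [e]
          refine sub_mem (Submodule.smul_mem _ _ (ih _ (weightLT_mono ?_ hh'))) (ih _ ?_)
          · have := hd i
            omega
          · have := mul_mem_weightLT hh' (hfg i)
            rwa [Nat.sub_add_cancel hdm] at this
        · exact zero_mem _
  have htop : Submodule.span (MvPolynomial ι K) S = ⊤ := by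
    rw [eq_top_iff]
    intro p _
    refine key (p.support.sup (Finsupp.weight w) + 1) p ?_
    rw [weightLT, mem_restrictSupport_iff]
    intro a ha
    exact Nat.lt_succ_of_le (Finset.le_sup (f := Finsupp.weight w) ha)
  exact (⟨⟨(hfin.image _).toFinset, by simpa using htop⟩⟩ :
    Module.Finite (MvPolynomial ι K) (MvPolynomial σ K))

end weightLT

/-- K[X] is algebraic over K[f], and there are only as many `f i` as the transcendence degree, so
the `f i` must be algebraically independent. -/
theorem aeval_injective_of_finite {σ ι K : Type*} [Field K] [Finite σ] [Finite ι]
    (hcard : Nat.card ι = Nat.card σ) {f : ι → MvPolynomial σ K}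
    (hf : (aeval (R := K) f : MvPolynomial ι K →ₐ[K] MvPolynomial σ K).toRingHom.Finite) :
    Function.Injective (aeval (R := K) f : MvPolynomial ι K →ₐ[K] MvPolynomial σ K) := by
  have hint : Algebra.IsAlgebraic (Algebra.adjoin K (Set.range f)) (MvPolynomial σ K) := by
    have : Algebra.IsIntegral (Algebra.adjoin K (Set.range f)) (MvPolynomial σ K) := by
      constructor
      intro x
      obtain ⟨p, hp, hx⟩ := hf.to_isIntegral x
      have hmem : ∀ a, (aeval (R := K) f : MvPolynomial ι K →ₐ[K] MvPolynomial σ K) a ∈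
          Algebra.adjoin K (Set.range f) := fun a => by
        rw [Algebra.adjoin_range_eq_range_aeval]
        exact ⟨a, rfl⟩
      let ψ := ((aeval (R := K) f : MvPolynomial ι K →ₐ[K] MvPolynomial σ K).codRestrict _ hmem).toRingHom
      refine ⟨p.map ψ, hp.map ψ, ?_⟩
      rw [Polynomial.eval₂_map]
      exact hx
    infer_instance
  refine (Algebra.IsAlgebraic.isTranscendenceBasis_of_lift_le_trdeg_of_finite K f ?_).1
  rw [trdeg_of_isDomain, ← Nat.cast_card (α := ι), ← Nat.cast_card (α := σ), hcard]
  simp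

end MvPolynomial

/-! ### Counting monomials of bounded weight. -/

section Counting

open Finsupp

variable {σ : Type*}

theorem Finsupp.finite_weight_lt [Finite σ] {w : σ → ℕ} (hw : ∀ i, 0 < w i) (m : ℕ) :
    Finite {a : σ →₀ ℕ // weight w a < m} :=
  Set.finite_coe_iff.2 <| finite_of_nat_weight_lt w (fun i => (hw i).ne') m

variable [Fintype σ] {w : σ → ℕ}

theorem Finsupp.card_weight_lt_le_pow (m : ℕ) :
    Nat.card {a : σ →₀ ℕ // weight (fun _ => 1) a < m} ≤ m ^ Fintype.card σ := by
  have hle : ∀ (a : {a : σ →₀ ℕ // weight (fun _ => 1) a < m}) (i : σ), a.1 i < m := fun a i =>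
    (le_weight (fun _ => 1) (s := i) one_ne_zero a.1).trans_lt a.2
  have := Nat.card_le_card_of_injective
    (fun (a : {a : σ →₀ ℕ // weight (fun _ => 1) a < m}) (i : σ) => (⟨a.1 i, hle a i⟩ : Fin m)) (by
      intro a b hab
      ext i
      simpa using congrFun hab i)
  simpa [Nat.card_fun] using this

/-- Divide each exponent by `w i`: remainders and quotients determine it. -/
theorem Finsupp.card_weight_one_le (hw : ∀ i, 0 < w i) (m : ℕ) :
    Nat.card {a : σ →₀ ℕ // weight (fun _ => 1) a < m} ≤
      (∏ i, w i) * Nat.card {a : σ →₀ ℕ // weight w a < m} := by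
  have := finite_weight_lt hw m
  have hdiv : ∀ a : {a : σ →₀ ℕ // weight (fun _ => 1) a < m},
      weight w (equivFunOnFinite.symm fun i => a.1 i / w i) < m := by
    intro a
    refine lt_of_le_of_lt ?_ a.2
    rw [weight_eq_sum, weight_eq_sum]
    refine Finset.sum_le_sum fun i _ => ?_
    simpa using Nat.div_mul_le_self _ _
  have := Nat.card_le_card_of_injective
    (fun a : {a : σ →₀ ℕ // weight (fun _ => 1) a < m} =>
      ((fun i => (⟨a.1 i % w i, Nat.mod_lt _ (hw i)⟩ : Fin (w i)), ⟨_, hdiv a⟩) :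
        (∀ i, Fin (w i)) × {a : σ →₀ ℕ // weight w a < m})) (by
      intro a b hab
      ext i
      simp only [Prod.mk.injEq, Subtype.mk.injEq] at hab
      have h1 := congrFun hab.1 i
      have h2 := DFunLike.congr_fun hab.2 i
      simp only [Fin.mk.injEq, equivFunOnFinite_symm_apply_apply] at h1 h2
      rw [← Nat.div_add_mod (a.1 i) (w i), h1, h2, Nat.div_add_mod])
  rw [Nat.card_prod] at this
  simpa [Nat.card_pi] using this

/-- The reverse of the division with remainder; the shift by `∑ i, w i` absorbs the remainders. -/
theorem Finsupp.prod_mul_card_weight_le (m : ℕ) :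
    (∏ i, w i) * Nat.card {a : σ →₀ ℕ // weight w a < m} ≤
      Nat.card {a : σ →₀ ℕ // weight (fun _ => 1) a < m + ∑ i, w i} := by
  have := finite_weight_lt (σ := σ) (w := fun _ => 1) (fun _ => one_pos) (m + ∑ i, w i)
  have hlt : ∀ x : (∀ i, Fin (w i)) × {a : σ →₀ ℕ // weight w a < m},
      weight (fun _ => 1) (equivFunOnFinite.symm fun i => x.2.1 i * w i + (x.1 i : ℕ)) <
        m + ∑ i, w i := by
    intro x
    have h2 := x.2.2
    rw [weight_eq_sum] at h2 ⊢
    simp only [equivFunOnFinite_symm_apply_apply, smul_eq_mul, mul_one, Finset.sum_add_distrib]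
      at h2 ⊢
    exact add_lt_add_of_lt_of_le h2 (Finset.sum_le_sum fun i _ => (x.1 i).2.le)
  have := Nat.card_le_card_of_injective
    (fun x : (∀ i, Fin (w i)) × {a : σ →₀ ℕ // weight w a < m} =>
      (⟨_, hlt x⟩ : {a : σ →₀ ℕ // weight (fun _ => 1) a < m + ∑ i, w i})) (by
      rintro ⟨r, a⟩ ⟨s, b⟩ hab
      have h : ∀ i, a.1 i * w i + (r i : ℕ) = b.1 i * w i + (s i : ℕ) := fun i => by
        simpa using DFunLike.congr_fun (congrArg Subtype.val hab) i
      have hr : r = s := by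
        ext i
        have := congrArg (· % w i) (h i)
        simpa [Nat.mod_eq_of_lt] using this
      subst hr
      have ha : a = b := by
        ext i
        have h1 := h i
        exact Nat.eq_of_mul_eq_mul_right (Nat.pos_of_ne_zero fun h0 => by
          have := (r i).2
          omega) (Nat.add_right_cancel h1)
      rw [ha])
  rw [Nat.card_prod] at this
  simpa [Nat.card_pi] using this

/-- A function of polynomial growth cannot satisfy `h (m + c) ≥ (A / B) h m` with `A > B`. -/
theorem Nat.le_of_mul_le_mul_shift {h : ℕ → ℕ} {n A B c : ℕ} (hpos : 0 < h 1)
    (hle : ∀ m, h m ≤ m ^ n) (hAB : ∀ m, A * h m ≤ B * h (m + c)) : A ≤ B := by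
  by_contra! hlt
  have hB : 0 < B := by
    rcases Nat.eq_zero_or_pos B with rfl | hB
    · have := hAB 1
      have := Nat.mul_pos hlt hpos
      omega
    · exact hB
  have hiter : ∀ k, A ^ k ≤ B ^ k * h (1 + k * c) := by
    intro k
    induction k with
    | zero => simpa using Nat.succ_le_of_lt hpos
    | succ k ih =>
      calc A ^ (k + 1) = A ^ k * A := pow_succ _ _
        _ ≤ (B ^ k * h (1 + k * c)) * A := Nat.mul_le_mul_right _ ih
        _ = B ^ k * (A * h (1 + k * c)) := by ring
        _ ≤ B ^ k * (B * h (1 + k * c + c)) := Nat.mul_le_mul_left _ (hAB _)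
        _ = B ^ (k + 1) * h (1 + (k + 1) * c) := by
          rw [show 1 + (k + 1) * c = 1 + k * c + c by ring]
          ring
  have hr : 1 < (A : ℝ) / B := by
    rw [one_lt_div (by exact_mod_cast hB)]
    exact_mod_cast hlt
  -- By `hiter`, (A / B)ᵏ is at most `h (1 + k * c)`, hence at most (1 + c)ⁿ kⁿ for k ≥ 1;
  -- exponential growth rules this out.
  have hlim := (tendsto_pow_const_div_const_pow_of_one_lt n hr).const_mul ((1 + c : ℝ) ^ n)
  rw [mul_zero] at hlim
  obtain ⟨k, hk, hk1⟩ := ((hlim.eventually (gt_mem_nhds one_pos)).and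
    (Filter.eventually_ge_atTop 1)).exists
  have hAk : (0 : ℝ) < ((A : ℝ) / B) ^ k := pow_pos (by linarith) _
  rw [← mul_div_assoc, div_lt_one hAk, div_pow, lt_div_iff₀ (by positivity)] at hk
  have h1 : A ^ k ≤ B ^ k * ((1 + c) ^ n * k ^ n) := by
    refine (hiter k).trans (Nat.mul_le_mul_left _ ((hle _).trans ?_))
    rw [← mul_pow]
    exact Nat.pow_le_pow_left (by nlinarith) _
  have h2 : ((A : ℝ)) ^ k ≤ B ^ k * ((1 + c) ^ n * k ^ n) := by exact_mod_cast h1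
  linarith

/-- The two counts grow like mⁿ / (n! ∏ d) and mⁿ / (n! ∏ w), so this compares leading coefficients.
Passing to weights 1 at the cost of a bounded shift avoids the asymptotics. -/
theorem Finsupp.mul_prod_le_prod_of_card_le {ι : Type*} [Fintype ι]
    (hcard : Fintype.card ι = Fintype.card σ) {d : ι → ℕ} (hd : ∀ i, 0 < d i) {r c : ℕ}
    (h : ∀ m, r * Nat.card {b : ι →₀ ℕ // weight d b < m} ≤
      Nat.card {a : σ →₀ ℕ // weight w a < m + c}) :
    r * ∏ i, w i ≤ ∏ i, d i := by
  have e := Fintype.equivOfCardEq hcard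
  refine Nat.le_of_mul_le_mul_shift (c := c + ∑ i, w i) (n := Fintype.card ι)
    (h := fun m => Nat.card {a : ι →₀ ℕ // weight (fun _ => 1) a < m}) ?_
    (fun m => card_weight_lt_le_pow m) ?_
  · have := finite_weight_lt (σ := ι) (w := fun _ => 1) (fun _ => one_pos) 1
    have : Nonempty {a : ι →₀ ℕ // weight (fun _ => 1) a < 1} := ⟨0, by simp⟩
    exact Nat.card_pos
  · intro m
    have hone : Nat.card {a : σ →₀ ℕ // weight (fun _ => 1) a < m + c + ∑ i, w i} =
        Nat.card {a : ι →₀ ℕ // weight (fun _ => 1) a < m + c + ∑ i, w i} := by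
      refine Nat.card_congr ((Finsupp.domCongr e.symm).toEquiv.subtypeEquiv fun a => ?_)
      simp only [weight_eq_sum]
      rw [← Equiv.sum_comp e.symm]
      simp [Finsupp.domCongr]
    have h1 := card_weight_one_le hd m
    have h2 := prod_mul_card_weight_le (w := w) (m + c)
    rw [hone] at h2
    calc r * (∏ i, w i) * Nat.card {a : ι →₀ ℕ // weight (fun _ => 1) a < m}
        ≤ r * (∏ i, w i) * ((∏ i, d i) * Nat.card {b : ι →₀ ℕ // weight d b < m}) :=
          Nat.mul_le_mul_left _ h1
      _ = (∏ i, w i) * (∏ i, d i) * (r * Nat.card {b : ι →₀ ℕ // weight d b < m}) := by ring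
      _ ≤ (∏ i, w i) * (∏ i, d i) * Nat.card {a : σ →₀ ℕ // weight w a < m + c} :=
          Nat.mul_le_mul_left _ (h m)
      _ = (∏ i, d i) * ((∏ i, w i) * Nat.card {a : σ →₀ ℕ // weight w a < m + c}) := by ring
      _ ≤ _ := Nat.mul_le_mul_left _ (by rw [← add_assoc]; exact h2)

end Counting

/-! ### The weighted Bézout bound. -/

namespace MvPolynomial

variable {σ ι K : Type*} [Field K] [Fintype σ] [Fintype ι] {w : σ → ℕ}

/-- The degree of a variable over the polynomial subring generated by `f` is bounded by the ratio
of the products of the weights, by comparison of Hilbert functions. -/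
theorem exists_monic_of_X_mem_radical (hcard : Fintype.card ι = Fintype.card σ)
    (hw : ∀ i, 0 < w i) {f g : ι → MvPolynomial σ K} {d : ι → ℕ} (hd : ∀ i, 0 < d i)
    (hg : ∀ i, IsWeightedHomogeneous w (g i) (d i))
    (hfg : ∀ i, f i - g i ∈ weightLT K w (d i))
    (hrad : ∀ j, X j ∈ (Ideal.span (Set.range g)).radical) (j : σ) :
    ∃ χ : Polynomial (MvPolynomial ι K), χ.Monic ∧
      χ.eval₂ (aeval (R := K) f : MvPolynomial ι K →ₐ[K] MvPolynomial σ K).toRingHom (X j) = 0 ∧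
      χ.natDegree * ∏ i, w i ≤ ∏ i, d i := by
  classical
  have hfinite := finite_aeval_of_X_mem_radical hd hg hfg hrad
  have hinj := aeval_injective_of_finite (by simpa using hcard) hfinite
  set φ : MvPolynomial ι K →ₐ[K] MvPolynomial σ K := aeval f
  let _ := φ.toRingHom.toAlgebra
  have hsmul : ∀ (a : MvPolynomial ι K) (p : MvPolynomial σ K), a • p = φ a * p := fun _ _ => rfl
  have : IsScalarTower K (MvPolynomial ι K) (MvPolynomial σ K) :=
    IsScalarTower.of_algebraMap_eq' φ.comp_algebraMap.symm
  have : FaithfulSMul (MvPolynomial ι K) (MvPolynomial σ K) :=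
    (faithfulSMul_iff_algebraMap_injective _ _).2 hinj
  have hint : IsIntegral (MvPolynomial ι K) (X j : MvPolynomial σ K) := hfinite.to_isIntegral _
  set χ := minpoly (MvPolynomial ι K) (X j : MvPolynomial σ K) with hχ
  refine ⟨χ, minpoly.monic hint, minpoly.aeval _ _, ?_⟩
  -- The base ring is integrally closed, so no nonzero polynomial, monic or not, of degree below
  -- that of `χ` kills `X j`.
  have hpow : LinearIndependent (MvPolynomial ι K)
      (fun k : Fin χ.natDegree => (X j : MvPolynomial σ K) ^ (k : ℕ)) := by
    rw [Fintype.linearIndependent_iff]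
    intro c hc
    by_contra! hne
    obtain ⟨k, hk⟩ := hne
    set P : Polynomial (MvPolynomial ι K) := ∑ i : Fin χ.natDegree, Polynomial.monomial i (c i)
    have hP : Polynomial.aeval (X j : MvPolynomial σ K) P = 0 := by
      simpa [P, Polynomial.aeval_monomial, Algebra.smul_def] using hc
    have hcoeff : P.coeff k = c k := by
      simp [P, Polynomial.coeff_monomial, Fin.val_inj]
    have hP0 : P ≠ 0 := fun h0 => hk (by rw [← hcoeff, h0, Polynomial.coeff_zero])
    have h1 := minpoly.IsIntegrallyClosed.degree_le_of_ne_zero hP0 hP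
    have h2 : P.degree < χ.natDegree := by
      refine (Polynomial.degree_sum_le _ _).trans_lt ?_
      rw [Finset.sup_lt_iff (WithBot.bot_lt_coe _)]
      intro i _
      exact (Polynomial.degree_monomial_le _ _).trans_lt (by exact_mod_cast i.2)
    rw [← hχ, Polynomial.degree_eq_natDegree (minpoly.monic hint).ne_zero] at h1
    exact absurd (h1.trans_lt h2) (lt_irrefl _)
  have hind := linearIndependent_smul (basisMonomials ι K).linearIndependent hpow
  -- The products f^b · X_j^k with k < deg χ are independent over K, and their weight exceeds that
  -- of b by at most deg χ · w_j, whence the constant `c`.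
  refine Finsupp.mul_prod_le_prod_of_card_le (c := χ.natDegree * w j) hcard hd fun m => ?_
  have hfw : ∀ i, f i ∈ weightLT K w (d i + 1) := fun i => by
    have := add_mem (weightLT_mono (Nat.le_succ _) (hfg i)) (hg i).mem_weightLT
    rwa [sub_add_cancel] at this
  have : Finite ({a : σ →₀ ℕ | Finsupp.weight w a < m + χ.natDegree * w j} : Set _) :=
    Finsupp.finite_weight_lt hw (m + χ.natDegree * w j)
  have := Finsupp.finite_weight_lt hd m
  let B : Module.Basis _ K (weightLT K w (m + χ.natDegree * w j)) := basisRestrictSupport K _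
  have hmem : ∀ x : {b : ι →₀ ℕ // Finsupp.weight d b < m} × Fin χ.natDegree,
      basisMonomials ι K x.1.1 • (X j : MvPolynomial σ K) ^ (x.2 : ℕ) ∈
        weightLT K w (m + χ.natDegree * w j) := by
    rintro ⟨b, k⟩
    have h1 : φ (basisMonomials ι K b.1) = b.1.prod (fun i k => f i ^ k) := by
      simp only [coe_basisMonomials, φ, aeval_monomial, map_one, one_mul]
    rw [hsmul, h1]
    have h2 := mul_mem_weightLT (prod_pow_mem_weightLT hfw b.1)
      (pow_mem_weightLT (X_mem_weightLT (K := K) (w := w) j) k)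
    refine weightLT_mono ?_ h2
    have h3 := b.2
    have h4 : (k : ℕ) * w j ≤ χ.natDegree * w j := Nat.mul_le_mul_right _ k.2.le
    omega
  have hind' : LinearIndependent K (fun x => (⟨_, hmem x⟩ : weightLT K w (m + χ.natDegree * w j))) := by
    refine LinearIndependent.of_comp (weightLT K w (m + χ.natDegree * w j)).subtype ?_
    exact hind.comp (fun x : {b : ι →₀ ℕ // Finsupp.weight d b < m} × Fin χ.natDegree =>
      (x.1.1, x.2)) (by
        rintro ⟨a, k⟩ ⟨b, l⟩ h
        simp only [Prod.mk.injEq] at h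
        exact Prod.ext (Subtype.ext h.1) h.2)
  have := Module.Finite.of_basis B
  have := Fintype.ofFinite {b : ι →₀ ℕ // Finsupp.weight d b < m}
  have h1 := hind'.fintype_card_le_finrank
  rw [Module.finrank_eq_nat_card_basis B, Fintype.card_prod, Fintype.card_fin, mul_comm,
    ← Nat.card_eq_fintype_card] at h1
  exact h1

/-- A weighted Bézout bound for the degree of the coordinates of a common zero. -/
theorem exists_monic_of_common_zero (hcard : Fintype.card ι = Fintype.card σ)
    (hw : ∀ i, 0 < w i) {f g : ι → MvPolynomial σ K} {d : ι → ℕ} (hd : ∀ i, 0 < d i)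
    (hg : ∀ i, IsWeightedHomogeneous w (g i) (d i))
    (hfg : ∀ i, f i - g i ∈ weightLT K w (d i))
    (hrad : ∀ j, X j ∈ (Ideal.span (Set.range g)).radical)
    {E : Type*} [CommRing E] [Algebra K E] {u : σ → E} (hu : ∀ i, aeval u (f i) = 0) (j : σ) :
    ∃ χ : Polynomial K, χ.Monic ∧ Polynomial.aeval (u j) χ = 0 ∧
      χ.natDegree * ∏ i, w i ≤ ∏ i, d i := by
  rcases subsingleton_or_nontrivial E with hE | hE
  · exact ⟨1, Polynomial.monic_one, Subsingleton.elim _ _, by simp⟩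
  obtain ⟨χ, hmon, hroot, hdeg⟩ := exists_monic_of_X_mem_radical hcard hw hd hg hfg hrad j
  -- Since every `f i` vanishes at `u`, evaluation at `u` factors through sending all variables of
  -- the base ring to 0.
  refine ⟨χ.map constantCoeff, hmon.map _, ?_, by rwa [hmon.natDegree_map]⟩
  have h := congrArg (aeval u : MvPolynomial σ K →ₐ[K] E).toRingHom hroot
  rw [Polynomial.hom_eval₂, map_zero] at h
  rw [Polynomial.aeval_def, Polynomial.eval₂_map]
  convert h using 2
  · refine MvPolynomial.ringHom_ext (fun c => ?_) fun i => ?_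
    · simp
    · simp [hu]
  · simp

end MvPolynomial

/-! ### Derivatives of powers and their recurrence. -/

section Derivation

open Finset

theorem Derivation.iterate_mul {R A : Type*} [CommSemiring R] [CommSemiring A] [Algebra R A]
    (D : Derivation R A A) (k : ℕ) (a b : A) :
    D^[k] (a * b) = ∑ ij ∈ antidiagonal k, (k.choose ij.1 : A) * (D^[ij.1] a * D^[ij.2] b) := by
  induction k with
  | zero => simp
  | succ k ih =>
    rw [sum_antidiagonal_choose_succ_mul (fun i j => D^[i] a * D^[j] b), Function.iterate_succ_apply', ih,
      map_sum, ← sum_add_distrib]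
    refine sum_congr rfl fun ij hij => ?_
    rw [Nat.choose_symm_of_eq_add (mem_antidiagonal.1 hij).symm]
    simp only [leibniz, Derivation.map_natCast, smul_eq_mul, Function.iterate_succ_apply']
    ring

/-- The recurrence for the derivatives of a power `z` of `y`. -/
theorem Derivation.iterate_succ_of_mul_eq {A : Type*} [CommRing A]
    (D : Derivation ℤ A A) {y z : A} {e : ℤ} (h : y * D z = e * (D y * z)) (k : ℕ) :
    y * D^[k + 1] z = ∑ ij ∈ antidiagonal k,
      ((e * k.choose ij.1 - k.choose (ij.1 + 1) : ℤ) : A) * (D^[ij.1 + 1] y * D^[ij.2] z) := by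
  have h1 := congrArg D^[k] h
  have hr : D^[k] ((e : A) * (D y * z)) = e * D^[k] (D y * z) := by
    induction k with
    | zero => rfl
    | succ k ih =>
      rw [Function.iterate_succ_apply', Function.iterate_succ_apply', ih (congrArg D^[k] h),
        ← zsmul_eq_mul, map_zsmul, zsmul_eq_mul]
  rw [hr, D.iterate_mul, D.iterate_mul] at h1
  simp only [← Function.iterate_succ_apply] at h1
  -- Splitting off the term without derivative on `y` and shifting the index puts both Leibniz sums
  -- over the same products.
  have h2 : ∑ ij ∈ antidiagonal k, (k.choose ij.1 : A) * (D^[ij.1] y * D^[ij.2 + 1] z) =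
      y * D^[k + 1] z + ∑ ij ∈ antidiagonal k,
        (k.choose (ij.1 + 1) : A) * (D^[ij.1 + 1] y * D^[ij.2] z) := by
    have h3 := Nat.sum_antidiagonal_succ (n := k)
      (f := fun ij => (k.choose ij.1 : A) * (D^[ij.1] y * D^[ij.2] z))
    rw [Nat.sum_antidiagonal_succ'] at h3
    simpa using h3
  simp only [Nat.succ_eq_add_one] at h1
  rw [h2] at h1
  rw [eq_sub_of_add_eq h1, mul_sum, ← sum_sub_distrib]
  refine sum_congr rfl fun ij _ => ?_
  push_cast
  ring

end Derivation

/-- If `X i` stands for `y⁽ⁱ⁾ / y`, then `powDerivSeq e X k` is `z⁽ᵏ⁾ / z` for `z = y ^ e`. -/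
noncomputable def powDerivSeq {S : Type*} [CommRing S] (e : ℤ) (X : ℕ → S) : ℕ → S
  | 0 => 1
  | k + 1 => ∑ j : Fin (k + 1),
      ((e * k.choose (k - j) - k.choose (k - j + 1) : ℤ) : S) * (X (k - j + 1) * powDerivSeq e X j)
  decreasing_by exact j.2

section powDerivSeq

variable {S : Type*} [CommRing S]

@[simp]
theorem powDerivSeq_zero (e : ℤ) (X : ℕ → S) : powDerivSeq e X 0 = 1 := by
  rw [powDerivSeq]

theorem powDerivSeq_succ (e : ℤ) (X : ℕ → S) (k : ℕ) :
    powDerivSeq e X (k + 1) = ∑ j : Fin (k + 1),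
      ((e * k.choose (k - j) - k.choose (k - j + 1) : ℤ) : S) *
        (X (k - j + 1) * powDerivSeq e X j) := by
  rw [powDerivSeq]

theorem map_powDerivSeq {T : Type*} [CommRing T] (φ : S →+* T) (e : ℤ) (X : ℕ → S) (k : ℕ) :
    φ (powDerivSeq e X k) = powDerivSeq e (fun i => φ (X i)) k := by
  induction k using Nat.strong_induction_on with
  | _ k ih =>
    cases k with
    | zero => simp
    | succ k =>
      rw [powDerivSeq_succ, powDerivSeq_succ, map_sum]
      refine Finset.sum_congr rfl fun j _ => ?_
      rw [map_mul, map_mul, map_intCast, ih j j.2]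

theorem iterate_deriv_div_eq_powDerivSeq {F : Type*} [Field F] (D : Derivation ℤ F F) {y : F}
    (hy : y ≠ 0) (e : ℤ) (k : ℕ) :
    D^[k] (y ^ e) / y ^ e = powDerivSeq e (fun i => D^[i] y / y) k := by
  have hz : y ^ e ≠ 0 := zpow_ne_zero _ hy
  have h : y * D (y ^ e) = e * (D y * y ^ e) := by
    rw [D.leibniz_zpow, zsmul_eq_mul, smul_eq_mul, zpow_sub_one₀ hy]
    field_simp
  induction k using Nat.strong_induction_on with
  | _ k ih =>
    cases k with
    | zero => simp [hz]
    | succ k =>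
      rw [powDerivSeq_succ, div_eq_iff hz]
      refine mul_left_cancel₀ hy ?_
      rw [D.iterate_succ_of_mul_eq h, Finset.Nat.sum_antidiagonal_eq_sum_range_succ_mk,
        ← Finset.sum_range_reflect, Finset.sum_range, Finset.sum_mul, Finset.mul_sum]
      refine Finset.sum_congr rfl fun j _ => ?_
      have hj : (j : ℕ) ≤ k := Nat.lt_succ_iff.1 j.2
      rw [← ih j j.2]
      simp only [Nat.add_sub_cancel, Nat.succ_eq_add_one, Nat.sub_sub_self hj]
      field_simp

/-- With `X i = 0` beyond `n`, each term depends only on the `n` preceding ones, so a window of `n`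
zeros propagates. -/
theorem powDerivSeq_eq_zero_of_le {e : ℤ} {X : ℕ → S} {n N : ℕ} (hX : ∀ i, n < i → X i = 0)
    (h0 : ∀ i < n, powDerivSeq e X (N + i) = 0) (hN : 0 < N) (k : ℕ) (hk : N ≤ k) :
    powDerivSeq e X k = 0 := by
  induction k using Nat.strong_induction_on with
  | _ k ih =>
    by_cases hkn : k < N + n
    · have := h0 (k - N) (by omega)
      rwa [Nat.add_sub_cancel' hk] at this
    obtain ⟨k, rfl⟩ : ∃ k', k = k' + 1 := ⟨k - 1, by omega⟩
    rw [powDerivSeq_succ]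
    refine Finset.sum_eq_zero fun j _ => ?_
    by_cases hj : N ≤ j
    · rw [ih j j.2 hj, mul_zero, mul_zero]
    · rw [hX _ (by omega), zero_mul, mul_zero]

/-- If `n` consecutive terms of the sequence vanish, then all `X i` do: otherwise the product of
the last nonzero `X r` and the last nonzero term `s` of the sequence would vanish. -/
theorem eq_zero_of_powDerivSeq_eq_zero [IsDomain S] {e : ℤ} {X : ℕ → S} {n N : ℕ}
    (hX : ∀ i, n < i → X i = 0) (h0 : ∀ i < n, powDerivSeq e X (N + i) = 0) (hN : 0 < N)
    (hc : ∀ r s, r < n → s < N →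
      ((e * (s + r).choose r - (s + r).choose (r + 1) : ℤ) : S) ≠ 0)
    (i : ℕ) (hi : 0 < i) : X i = 0 := by
  classical
  by_contra hXi
  have hvan := powDerivSeq_eq_zero_of_le hX h0 hN
  have hin : i ≤ n := not_lt.1 fun h => hXi (hX i h)
  set r := Nat.findGreatest (fun i => X i ≠ 0) n
  have hir : i ≤ r := Nat.le_findGreatest hin hXi
  have hr : X r ≠ 0 := Nat.findGreatest_spec (P := fun i => X i ≠ 0) hin hXi
  have hrn : r ≤ n := Nat.findGreatest_le n
  have hr' : ∀ j, r < j → X j = 0 := fun j hj => by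
    by_cases hjn : j ≤ n
    · exact not_not.1 (Nat.findGreatest_is_greatest hj hjn)
    · exact hX j (not_le.1 hjn)
  set s := Nat.findGreatest (fun i => powDerivSeq e X i ≠ 0) N
  have hs : powDerivSeq e X s ≠ 0 :=
    Nat.findGreatest_spec (P := fun i => powDerivSeq e X i ≠ 0) (Nat.zero_le N) (by simp)
  have hsN : s < N := not_le.1 fun h => hs (hvan s h)
  have hs' : ∀ j, s < j → powDerivSeq e X j = 0 := fun j hj => by
    by_cases hjn : j ≤ N
    · exact not_not.1 (Nat.findGreatest_is_greatest hj hjn)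
    · exact hvan j (not_le.1 hjn).le
  obtain ⟨t, ht⟩ : ∃ t, r = t + 1 := ⟨r - 1, by omega⟩
  have h := hs' (s + t + 1) (by omega)
  -- In the term of index s + r only the summand `j = s` survives: `j < s` calls for some `X i` with
  -- i > r, and `j > s` for a term of the sequence past its last nonzero one.
  rw [powDerivSeq_succ, Finset.sum_eq_single (⟨s, by omega⟩ : Fin (s + t + 1))] at h
  · simp only [Nat.add_sub_cancel_left, ← ht] at h
    have h1 := hc t s (by omega) hsN
    rw [← ht] at h1
    exact mul_ne_zero h1 (mul_ne_zero hr hs) h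
  · intro j _ hj
    have hne : (j : ℕ) ≠ s := fun h => hj (Fin.ext h)
    rcases lt_or_gt_of_ne hne with hlt | hgt
    · rw [hr' _ (by omega), zero_mul, mul_zero]
    · rw [hs' _ hgt, mul_zero, mul_zero]
  · simp

open MvPolynomial in
theorem isWeightedHomogeneous_powDerivSeq {σ K : Type*} [CommRing K] {w : σ → ℕ} {e : ℤ}
    {Y : ℕ → MvPolynomial σ K} (hY : ∀ i, IsWeightedHomogeneous w (Y i) i) (k : ℕ) :
    IsWeightedHomogeneous w (powDerivSeq e Y k) k := by
  induction k using Nat.strong_induction_on with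
  | _ k ih =>
    cases k with
    | zero => simpa using isWeightedHomogeneous_one K w
    | succ k =>
      rw [powDerivSeq_succ]
      refine IsWeightedHomogeneous.sum _ _ _ fun j _ => ?_
      rw [← map_intCast (C (σ := σ) (R := K))]
      refine IsWeightedHomogeneous.C_mul ?_ _
      convert (hY (k - j + 1)).mul (ih j j.2) using 1
      omega

-- By induction along the recurrence: in each product, replacing one factor at a time by its leading
-- form costs only lower weight.
open MvPolynomial in
theorem powDerivSeq_sub_mem_weightLT {σ K : Type*} [CommRing K] {w : σ → ℕ} {e : ℤ}
    {X Y : ℕ → MvPolynomial σ K} (hY : ∀ i, IsWeightedHomogeneous w (Y i) i)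
    (hXY : ∀ i, 0 < i → X i - Y i ∈ weightLT K w i) (k : ℕ) :
    powDerivSeq e X k - powDerivSeq e Y k ∈ weightLT K w k := by
  induction k using Nat.strong_induction_on with
  | _ k ih =>
    cases k with
    | zero => simp
    | succ k =>
      rw [powDerivSeq_succ, powDerivSeq_succ, ← Finset.sum_sub_distrib]
      refine sum_mem fun j _ => ?_
      rw [← mul_sub, ← zsmul_eq_mul]
      refine zsmul_mem ?_ _
      have h1 : powDerivSeq e X j ∈ weightLT K w (j + 1) := by
        have := add_mem (weightLT_mono (Nat.le_succ _) (ih j j.2))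
          (isWeightedHomogeneous_powDerivSeq (e := e) hY j).mem_weightLT
        rwa [sub_add_cancel] at this
      have h2 := mul_mem_weightLT h1 (hXY (k - j + 1) (Nat.succ_pos _))
      have h3 := mul_mem_weightLT (hY (k - j + 1)).mem_weightLT (ih j j.2)
      have e1 : (j : ℕ) + (k - j + 1) = k + 1 := by omega
      have e2 : k - j + 1 + (j : ℕ) = k + 1 := by omega
      rw [e1] at h2
      rw [e2] at h3
      convert add_mem h2 h3 using 1
      ring

end powDerivSeq

/-- Multiplied by r + 1, the combination becomes `(s + r).choose r * (e * (r + 1) - s)`, and the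
binomial is prime to `p` because s + r < p. -/
theorem Int.not_dvd_choose_combination {p : ℕ} {e : ℤ} {r s : ℕ} (hp : p = 0 ∨ p.Prime)
    (hlt : p = 0 ∨ s + r < p) (hes : ¬ (p : ℤ) ∣ e * (r + 1) - s) :
    ¬ (p : ℤ) ∣ e * (s + r).choose r - (s + r).choose (r + 1) := by
  intro h
  have h1 : (((s + r).choose (r + 1) : ℤ)) * (r + 1) = (s + r).choose r * s := by
    have := Nat.choose_succ_right_eq (s + r) r
    rw [Nat.add_sub_cancel] at this
    exact_mod_cast this
  have h2 : (p : ℤ) ∣ (s + r).choose r * (e * (r + 1) - s) := by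
    rw [show ((s + r).choose r : ℤ) * (e * (r + 1) - s) =
      (e * (s + r).choose r - (s + r).choose (r + 1)) * (r + 1) by linear_combination h1]
    exact h.mul_right _
  have h3 : ¬ (p : ℤ) ∣ (s + r).choose r := by
    rw [Int.natCast_dvd_natCast]
    rcases hp with rfl | hp
    · rw [zero_dvd_iff]
      exact (Nat.choose_pos (Nat.le_add_left r s)).ne'
    · intro h4
      have h5 := (h4.mul_right r.factorial).mul_right (s + r - r).factorial
      rw [Nat.choose_mul_factorial_mul_factorial (Nat.le_add_left r s), hp.dvd_factorial] at h5
      have := hp.pos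
      omega
  rcases hp with rfl | hp
  · simp only [Nat.cast_zero, zero_dvd_iff, mul_eq_zero] at h2 h3 hes
    tauto
  · rcases (Nat.prime_iff_prime_int.1 hp).dvd_or_dvd h2 with h | h
    · exact h3 h
    · exact hes h

/-! ### From linear differential equations to polynomial equations. -/

namespace HomLinDiffPoly

variable {K F : Type*} [Field K] [Differential K] [Field F] [Differential F]
  [Algebra K F] [DifferentialAlgebra K F]

/-- The K-span of y, …, D^(N−1) y is stable under D: the equation handles D^N y, and D maps K to
itself. -/
theorem exists_iterate_deriv_eq_sum {L : HomLinDiffPoly K} {N : ℕ} (hL : L.HasOrder N) {y : F}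
    (hy : L.eval y = 0) (i : ℕ) :
    ∃ c : Fin N → K, (Differential.deriv : Derivation ℤ F F)^[i] y =
      ∑ j, c j • (Differential.deriv : Derivation ℤ F F)^[(j : ℕ)] y := by
  set D : Derivation ℤ F F := Differential.deriv with hD
  set M : Submodule K F := Submodule.span K (Set.range fun j : Fin N => D^[(j : ℕ)] y) with hM
  have hlow : ∀ j < N, D^[j] y ∈ M := fun j hj => Submodule.subset_span ⟨⟨j, hj⟩, rfl⟩
  have hN : D^[N] y ∈ M := by
    have h1 : L.coeff N • D^[N] y = - ∑ i ∈ L.coeff.support.erase N, L.coeff i • D^[i] y := by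
      rw [eq_neg_iff_add_eq_zero, Finset.add_sum_erase _ (fun i => L.coeff i • D^[i] y)
        (Finsupp.mem_support_iff.2 hL.1), ← hy, HomLinDiffPoly.eval, Finsupp.sum]
      exact Finset.sum_congr rfl fun i _ => Algebra.smul_def _ _
    rw [← Submodule.smul_mem_iff M hL.1, h1]
    refine neg_mem (sum_mem fun i hi => M.smul_mem _ (hlow i ?_))
    rw [Finset.mem_erase, Finsupp.mem_support_iff] at hi
    by_contra hlt
    exact hi.2 (hL.2 i (by omega))
  have hstable : ∀ x ∈ M, D x ∈ M := by
    intro x hx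
    induction hx using Submodule.span_induction with
    | mem x hx =>
      obtain ⟨j, rfl⟩ := hx
      simp only [← Function.iterate_succ_apply' (f := D)]
      rcases (Nat.succ_le_of_lt j.2).lt_or_eq with h | h
      · exact hlow _ h
      · rw [h]
        exact hN
    | zero => simp
    | add x y _ _ hx hy =>
      rw [map_add]
      exact add_mem hx hy
    | smul c x hxM hx =>
      rw [Algebra.smul_def, D.leibniz, hD, DifferentialAlgebra.deriv_algebraMap, ← hD, smul_eq_mul,
        smul_eq_mul, mul_comm x, ← Algebra.smul_def, ← Algebra.smul_def]
      exact add_mem (M.smul_mem _ hx) (M.smul_mem _ hxM)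
  have hall : ∀ i, D^[i] y ∈ M := by
    intro i
    induction i with
    | zero =>
      rcases Nat.eq_zero_or_pos N with h | h
      · rw [h] at hN
        exact hN
      · exact hlow 0 h
    | succ i ih =>
      rw [Function.iterate_succ_apply']
      exact hstable _ ih
  obtain ⟨c, hc⟩ := (Submodule.mem_span_range_iff_exists_fun K).1 (hall i)
  exact ⟨c, hc.symm⟩

open MvPolynomial in
/-- The common core of the two parts: `y` and its power `z = y ^ e` are both solutions of linear
differential equations, and the exponent `e` is generic with respect to the characteristic. -/
theorem algebraicOfDegreeLE_of_eval_zpow_eq_zero {p : ℕ} [CharP K p] {n N : ℕ} (hN : 0 < N)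
    {L₁ L₂ : HomLinDiffPoly K} (hL₁ : L₁.HasOrder (n + 1)) (hL₂ : L₂.HasOrder N)
    {y : F} (hy : y ≠ 0) (hy₁ : L₁.eval y = 0) {e : ℤ} (hy₂ : L₂.eval (y ^ e) = 0)
    (hp : p = 0 ∨ N + n ≤ p + 1)
    (he : ∀ r s : ℕ, r < n → s < N → ¬ (p : ℤ) ∣ e * (r + 1) - s)
    {j : ℕ} (hj : 0 < j) (hjn : j ≤ n) :
    AlgebraicOfDegreeLE K ((Differential.deriv : Derivation ℤ F F)^[j] y / y)
      ((N + n - 1).choose n) := by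
  set D : Derivation ℤ F F := Differential.deriv with hD
  let w : Fin n → ℕ := fun i => i + 1
  let u : Fin n → F := fun i => D^[(i : ℕ) + 1] y / y
  -- `Y` is the truncated family of variables, zero beyond `n`; `Z` below agrees with it up to `n`
  -- and beyond uses L₁, so that it evaluates to Dⁱy / y for every i.
  let Y : ℕ → MvPolynomial (Fin n) K := fun i =>
    if i = 0 then 1 else if h : i - 1 < n then X ⟨i - 1, h⟩ else 0
  have hYhom : ∀ i, IsWeightedHomogeneous w (Y i) i := by
    intro i
    simp only [Y]
    split_ifs with h h'
    · subst h
      exact isWeightedHomogeneous_one K w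
    · convert isWeightedHomogeneous_X K w ⟨i - 1, h'⟩ using 1
      exact (Nat.sub_add_cancel (Nat.pos_of_ne_zero h)).symm
    · exact isWeightedHomogeneous_zero K w i
  have hYeval : ∀ i ≤ n, aeval u (Y i) = D^[i] y / y := by
    intro i hi
    simp only [Y]
    split_ifs with h h'
    · subst h
      simp [hy]
    · rw [aeval_X]
      simp only [u]
      rw [Nat.sub_add_cancel (Nat.pos_of_ne_zero h)]
    · omega
  choose c₁ hc₁ using fun i => exists_iterate_deriv_eq_sum hL₁ hy₁ i
  choose c₂ hc₂ using fun i => exists_iterate_deriv_eq_sum hL₂ hy₂ i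
  let Z : ℕ → MvPolynomial (Fin n) K := fun i =>
    if i ≤ n then Y i else ∑ k : Fin (n + 1), c₁ i k • Y k
  have hZeval : ∀ i, aeval u (Z i) = D^[i] y / y := by
    intro i
    simp only [Z]
    split_ifs with h
    · exact hYeval i h
    · rw [hD, hc₁ i, ← hD, map_sum, Finset.sum_div]
      refine Finset.sum_congr rfl fun k _ => ?_
      rw [map_smul, hYeval _ (Nat.lt_succ_iff.1 k.2), smul_div_assoc]
  have hZY : ∀ i, 0 < i → Z i - Y i ∈ weightLT K w i := by
    intro i hi
    simp only [Z]
    split_ifs with h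
    · simp
    · have : Y i = 0 := by
        simp only [Y]
        rw [if_neg hi.ne', dif_neg (by omega)]
      rw [this, sub_zero]
      refine sum_mem fun k _ => Submodule.smul_mem _ _ (weightLT_mono ?_ (hYhom k).mem_weightLT)
      have := k.2
      omega
  let g : Fin n → MvPolynomial (Fin n) K := fun i => powDerivSeq e Y (N + i)
  let f : Fin n → MvPolynomial (Fin n) K := fun i =>
    powDerivSeq e Z (N + i) - ∑ k : Fin N, c₂ (N + i) k • powDerivSeq e Z k
  have hPeval : ∀ k, aeval u (powDerivSeq e Z k) = D^[k] (y ^ e) / y ^ e := by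
    intro k
    rw [iterate_deriv_div_eq_powDerivSeq D hy]
    have := map_powDerivSeq (aeval u : MvPolynomial (Fin n) K →ₐ[K] F).toRingHom e Z k
    simpa [hZeval] using this
  have hu : ∀ i, aeval u (f i) = 0 := by
    intro i
    simp only [f, map_sub, map_sum, map_smul, hPeval]
    rw [hD, hc₂ (N + i), ← hD, Finset.sum_div, sub_eq_zero]
    exact Finset.sum_congr rfl fun k _ => smul_div_assoc _ _ _
  have hfg : ∀ i : Fin n, f i - g i ∈ weightLT K w (N + i) := by
    intro i
    have h1 := powDerivSeq_sub_mem_weightLT (e := e) hYhom hZY (N + i)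
    have h2 : ∑ k : Fin N, c₂ (N + i) k • powDerivSeq e Z k ∈ weightLT K w (N + i) := by
      refine sum_mem fun k _ => Submodule.smul_mem _ _ ?_
      have h3 := add_mem
        (weightLT_mono (Nat.le_succ _) (powDerivSeq_sub_mem_weightLT (e := e) hYhom hZY k))
        (isWeightedHomogeneous_powDerivSeq (e := e) hYhom k).mem_weightLT
      rw [sub_add_cancel] at h3
      refine weightLT_mono ?_ h3
      have := k.2
      omega
    convert sub_mem h1 h2 using 1
    simp only [f, g]
    ring
  have hrad : ∀ j, X j ∈ (Ideal.span (Set.range g)).radical := by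
    intro j
    -- Testing against every prime containing the `g i` reduces the claim to a common zero in a
    -- domain, without passing to an algebraic closure.
    rw [Ideal.radical_eq_sInf, Submodule.mem_sInf]
    rintro J ⟨hgJ, hJ⟩
    let π := Ideal.Quotient.mk J
    have hseq : ∀ k, powDerivSeq e (fun i => π (Y i)) k = π (powDerivSeq e Y k) := fun k =>
      (map_powDerivSeq π e Y k).symm
    have h := eq_zero_of_powDerivSeq_eq_zero (e := e) (X := fun i => π (Y i)) (n := n) (N := N)
      (fun i hi => by
        have : Y i = 0 := by
          simp only [Y]
          rw [if_neg (by omega), dif_neg (by omega)]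
        rw [this, map_zero])
      (fun i hi => by
        rw [hseq]
        exact Ideal.Quotient.eq_zero_iff_mem.2 (hgJ (Ideal.subset_span ⟨⟨i, hi⟩, rfl⟩)))
      hN
      (fun r s hr hs => by
        have : CharP (MvPolynomial (Fin n) K ⧸ J) p :=
          charP_of_injective_algebraMap (algebraMap K _).injective p
        rw [Ne, CharP.intCast_eq_zero_iff (MvPolynomial (Fin n) K ⧸ J) p]
        -- Here r + s ≤ N + n − 2, which is below `p` when `p` is not 0.
        refine Int.not_dvd_choose_combination (CharP.char_is_prime_or_zero K p).symm ?_ (he r s hr hs)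
        omega)
      (j + 1) (Nat.succ_pos _)
    have hYj : Y (j + 1) = X j := by
      simp only [Y]
      rw [if_neg (Nat.succ_ne_zero _), dif_pos (by simp)]
      rfl
    rw [hYj] at h
    exact Ideal.Quotient.eq_zero_iff_mem.1 h
  obtain ⟨χ, hmon, hroot, hdeg⟩ := exists_monic_of_common_zero (d := fun i : Fin n => N + i) rfl
    (fun i => Nat.succ_pos _) (fun i => by omega)
    (fun i => isWeightedHomogeneous_powDerivSeq hYhom _) hfg hrad hu ⟨j - 1, by omega⟩
  have huj : u ⟨j - 1, by omega⟩ = D^[j] y / y := by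
    simp only [u]
    rw [Nat.sub_add_cancel hj]
  rw [huj] at hroot
  have hw : ∏ i : Fin n, w i = n.factorial := by
    rw [← Finset.prod_range_add_one_eq_factorial, Finset.prod_range]
  have hd : ∏ i : Fin n, (N + (i : ℕ)) = n.factorial * (N + n - 1).choose n := by
    rw [← Nat.ascFactorial_eq_factorial_mul_choose', Nat.ascFactorial_eq_prod_range,
      Finset.prod_range]
  rw [hw, hd, mul_comm] at hdeg
  refine ⟨⟨χ, hmon.ne_zero, hroot⟩, ?_⟩
  exact (Polynomial.natDegree_le_of_dvd (minpoly.dvd K _ hroot) hmon.ne_zero).trans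
    (Nat.le_of_mul_le_mul_left hdeg n.factorial_pos)

end HomLinDiffPoly

/-! ### The exponents e = −1 and e = q. -/

theorem theorem3p1 {K F : Type*} [Field K] [Differential K] [Field F] [Differential F]
    [Algebra K F] [DifferentialAlgebra K F]
    (p : ℕ) [CharP K p] (hK : p = 0 ∨ (Infinite K ∧ PerfectField K))
    (N₁ N₂ : ℕ) (hN₁ : 1 < N₁) (hN₂ : 1 < N₂)
    (L₁ L₂ : HomLinDiffPoly K) (hL₁ : L₁.HasOrder N₁) (hL₂ : L₂.HasOrder N₂)
    (y : F) (hy : y ≠ 0) (hy₁ : L₁.eval y = 0) :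
    ((p = 0 ∨ N₁ + N₂ - 2 < p) → L₂.eval (1 / y) = 0 →
      ∀ j : ℕ, 1 ≤ j → j ≤ N₁ - 1 →
        AlgebraicOfDegreeLE K ((Differential.deriv : Derivation ℤ F F)^[j] y / y)
          (Nat.choose (N₂ + N₁ - 2) (N₁ - 1))) ∧
    (∀ q : ℕ, N₂ ≤ q → (p = 0 ∨ (q + 1) * (N₁ - 1) - 1 < p) → L₂.eval (y ^ q) = 0 →
      ∀ j : ℕ, 1 ≤ j → j ≤ N₁ - 1 →
        AlgebraicOfDegreeLE K ((Differential.deriv : Derivation ℤ F F)^[j] y / y)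
          (Nat.choose (q * (N₁ - 1) + N₁ - 2) (N₁ - 1))) := by
  obtain ⟨n, rfl⟩ : ∃ n, N₁ = n + 1 := ⟨N₁ - 1, by omega⟩
  have hN : 0 < N₂ := by omega
  simp only [Nat.add_sub_cancel]
  refine ⟨fun hp hy₂ j hj hjn => ?_, fun q hq hp hy₂ j hj hjn => ?_⟩
  · rw [show N₂ + (n + 1) - 2 = N₂ + n - 1 by omega]
    refine HomLinDiffPoly.algebraicOfDegreeLE_of_eval_zpow_eq_zero (p := p) (e := -1) hN hL₁ hL₂ hy
      hy₁ (by rwa [zpow_neg_one, ← one_div]) (by omega) (fun r s hr hs h => ?_) hj hjn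
    rcases hp with rfl | hp
    · rw [Nat.cast_zero, zero_dvd_iff] at h
      omega
    -- For e = −1, up to sign, the number to test is r + 1 + s, positive and at most n + N₂ − 1 < p.
    · have h1 : (p : ℤ) ∣ ((r + 1 + s : ℕ) : ℤ) := by
        rw [← dvd_neg, show -((r + 1 + s : ℕ) : ℤ) = -1 * (r + 1) - s by push_cast; ring]
        exact h
      have := Nat.le_of_dvd (by omega) (Int.natCast_dvd_natCast.1 h1)
      omega
  · have hqn : q ≤ q * n := Nat.le_mul_of_pos_right q (by omega)
    have hle : N₂ + n - 1 ≤ q * n + (n + 1) - 2 := by omega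
    have hp' : p = 0 ∨ q * n + n - 1 < p := by rwa [add_mul, one_mul] at hp
    -- As N₂ ≤ q ≤ q n, the bound from the common core is at least as sharp as the one required.
    suffices h : AlgebraicOfDegreeLE K ((Differential.deriv : Derivation ℤ F F)^[j] y / y)
        ((N₂ + n - 1).choose n) from ⟨h.1, h.2.trans (Nat.choose_le_choose n hle)⟩
    refine HomLinDiffPoly.algebraicOfDegreeLE_of_eval_zpow_eq_zero (p := p) (e := q) hN hL₁ hL₂ hy
      hy₁ (by rwa [zpow_natCast]) (by omega) (fun r s hr hs h => ?_) hj hjn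
    have h1 : q ≤ q * (r + 1) := Nat.le_mul_of_pos_right q (Nat.succ_pos r)
    have h2 : q * (r + 1) ≤ q * n := Nat.mul_le_mul_left q hr
    -- Since s < N₂ ≤ q, the subtraction does not truncate and is positive; it is at most q n ≤ q n
    -- + n − 1, hence below a nonzero `p`.
    have h3 : (p : ℤ) ∣ ((q * (r + 1) - s : ℕ) : ℤ) := by
      rw [Nat.cast_sub (by omega)]
      exact_mod_cast h
    rcases hp' with rfl | hp'
    · rw [Int.natCast_dvd_natCast, zero_dvd_iff] at h3
      omega
    · have := Nat.le_of_dvd (by omega) (Int.natCast_dvd_natCast.1 h3)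
      omega
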